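/- Let $S$ be a scheme; all schemes and morphisms are over $S$, and products are over $S$. Let $G$ be a group scheme over $S$ that is flat and affine over $S$, acting on a separated $S$-scheme $X$; write $m,p\colon G\times X\to X$ for the action and the projection. Assume that $X$ has a covering by affine open subschemes $\{U_i\}$ such that each $U_i$ is $G$-invariant and admits a $G$-equivariant $S$-morphism $\sigma_i\colon U_i\to G$, where $G$ acts on itself by left multiplication. Then there exist an $S$-scheme $Z$ and an $S$-morphism $\pi\colon X\to Z$ such that: (a) $\pi$ is a universal categorical quotient of $X$ by $G$: one has $\pi m=\pi p$, and for every morphism of $S$-schemes $Z'\to Z$, the base change $\pi'\colon X'=X\times_Z Z'\to Z'$, with the induced action of $G$ on $X'$ and the corresponding $m',p'\colon G\times X'\to X'$, satisfies $\pi'm'=\pi'p'$ and every $S$-morphism $\psi\colon X'\to T$ with $\psi m'=\psi p'$ factors uniquely through $\pi'$; (b) $\pi$ is a Zariski locally trivial principal $G$-bundle: $\pi m=\pi p$, and $Z$ has an open covering $\{W_j\}$ such that for each $j$ there is a $G$-equivariant isomorphism $G\times W_j\simeq\pi^{-1}(W_j)$ over $W_j$, where $G$ acts on $G\times W_j$ by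 left multiplication on the first factor. -/

import Mathlib

open CategoryTheory Limits MonoidalCategory CartesianMonoidalCategory AlgebraicGeometry

universe u

noncomputable section

/-- For a group scheme `G` over `S`, the category of `G`-schemes: `S`-schemes with a left
`G`-action, and `G`-equivariant `S`-morphisms. -/
abbrev GScheme {S : Scheme.{u}} (G : Over S) [GrpObj G] := Mod (Over S) G

namespace GScheme

variable {S : Scheme.{u}} {G : Over S} [GrpObj G]

/-- The action morphism `m : G × X ⟶ X`. -/
abbrev act (X : GScheme G) : G ⊗ X.X ⟶ X.X := ModObj.smul (M := G) (X := X.X)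

/-- The projection morphism `p : G × X ⟶ X`. -/
abbrev proj (X : GScheme G) : G ⊗ X.X ⟶ X.X := snd G X.X

lemma one_act (X : GScheme G) : MonObj.one (X := G) ▷ X.X ≫ X.act = (λ_ X.X).hom :=
  ModObj.one_smul_self G X.X

lemma mul_act (X : GScheme G) :
    MonObj.mul (X := G) ▷ X.X ≫ X.act = (α_ G G X.X).hom ≫ G ◁ X.act ≫ X.act :=
  ModObj.mul_smul_self G X.X

/-- `G` acting on itself by left multiplication. -/
abbrev leftMul (G : Over S) [GrpObj G] : GScheme G := Mod.regular G

/-- `G × W` with `G` acting by left multiplication on the first factor. -/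
abbrev trivialGScheme (G : Over S) [GrpObj G] (W : Over S) : GScheme G where
  X := G ⊗ W
  mod :=
    { smul := (α_ G G W).inv ≫ MonObj.mul (X := G) ▷ W
      one_smul := by
        change MonObj.one (X := G) ▷ (G ⊗ W) ≫ (α_ G G W).inv ≫ MonObj.mul (X := G) ▷ W =
          (λ_ (G ⊗ W)).hom
        rw [associator_inv_naturality_left_assoc, ← comp_whiskerRight, MonObj.one_mul]
        monoidal
      mul_smul := by
        change MonObj.mul (X := G) ▷ (G ⊗ W) ≫ (α_ G G W).inv ≫ MonObj.mul (X := G) ▷ W =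
          (α_ G G (G ⊗ W)).hom ≫ G ◁ ((α_ G G W).inv ≫ MonObj.mul (X := G) ▷ W) ≫
            (α_ G G W).inv ≫ MonObj.mul (X := G) ▷ W
        rw [associator_inv_naturality_left_assoc, ← comp_whiskerRight, MonObj.mul_assoc]
        simp only [comp_whiskerRight, whiskerLeft_comp, Category.assoc]
        monoidal }

/-- An open subscheme, as a scheme over `S`. -/
abbrev openSub (X : Over S) (U : X.left.Opens) : Over S := Over.mk (U.ι ≫ X.hom)

/-- The inclusion of an open subscheme, as a morphism over `S`. -/
abbrev openIncl (X : Over S) (U : X.left.Opens) : openSub X U ⟶ X := Over.homMk U.ι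

instance (X : Over S) (U : X.left.Opens) : Mono (openIncl X U) :=
  (Over.forget S).mono_of_mono_map (inferInstanceAs (Mono U.ι))

/-- An open subscheme `U` of `X` is `G`-invariant if the action maps `G × U` into `U`. -/
def IsInvariant (X : GScheme G) (U : X.X.left.Opens) : Prop :=
  X.proj.left ⁻¹ᵁ U ≤ X.act.left ⁻¹ᵁ U

lemma range_act_subset (X : GScheme G) (U : X.X.left.Opens) (hU : X.IsInvariant U) :
    Set.range ((G ◁ openIncl X.X U) ≫ X.act).left ⊆ Set.range U.ι := by
  rw [Set.range_subset_iff]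
  intro y
  have hp : (X.proj).left ((G ◁ openIncl X.X U).left y) ∈ U := by
    rw [← Scheme.Hom.comp_apply, ← Over.comp_left, whiskerLeft_snd, Over.comp_left,
      Scheme.Hom.comp_apply]
    exact ((snd G (openSub X.X U)).left y).2
  rw [Scheme.Opens.range_ι, Over.comp_left, Scheme.Hom.comp_apply]
  exact hU hp

/-- The restriction `G × U ⟶ U` of the action to a `G`-invariant open subscheme. -/
def restrictAct (X : GScheme G) (U : X.X.left.Opens) (hU : X.IsInvariant U) :
    G ⊗ openSub X.X U ⟶ openSub X.X U :=
  Over.homMk (IsOpenImmersion.lift U.ι ((G ◁ openIncl X.X U) ≫ X.act).left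
      (X.range_act_subset U hU))
    ((IsOpenImmersion.lift_fac_assoc U.ι _ (X.range_act_subset U hU) X.X.hom).trans
      (Over.w ((G ◁ openIncl X.X U) ≫ X.act)))

lemma restrictAct_incl (X : GScheme G) (U : X.X.left.Opens) (hU : X.IsInvariant U) :
    X.restrictAct U hU ≫ openIncl X.X U = G ◁ openIncl X.X U ≫ X.act := by
  ext1
  exact IsOpenImmersion.lift_fac _ _ _

/-- A `G`-invariant open subscheme, as a `G`-scheme. -/
abbrev restrict (X : GScheme G) (U : X.X.left.Opens) (hU : X.IsInvariant U) : GScheme G where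
  X := openSub X.X U
  mod :=
    { smul := X.restrictAct U hU
      one_smul := by
        change MonObj.one (X := G) ▷ openSub X.X U ≫ X.restrictAct U hU = (λ_ (openSub X.X U)).hom
        rw [← cancel_mono (openIncl X.X U), Category.assoc, restrictAct_incl,
          ← whisker_exchange_assoc, one_act, leftUnitor_naturality]
      mul_smul := by
        change MonObj.mul (X := G) ▷ openSub X.X U ≫ X.restrictAct U hU =
          (α_ G G (openSub X.X U)).hom ≫ G ◁ X.restrictAct U hU ≫ X.restrictAct U hU
        rw [← cancel_mono (openIncl X.X U)]
        simp only [Category.assoc, restrictAct_incl]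
        rw [← whiskerLeft_comp_assoc, restrictAct_incl, ← whisker_exchange_assoc, mul_act]
        simp }

/-- `π : X ⟶ Z` is `G`-invariant: `π ∘ m = π ∘ p`. -/
def IsInvariantHom (X : GScheme G) {Z : Over S} (π : X.X ⟶ Z) : Prop :=
  X.act ≫ π = X.proj ≫ π

lemma IsInvariantHom.preimage {X : GScheme G} {Z : Over S} {π : X.X ⟶ Z}
    (h : X.IsInvariantHom π) (W : Z.left.Opens) : X.IsInvariant (π.left ⁻¹ᵁ W) := by
  unfold IsInvariant
  rw [← Scheme.Hom.comp_preimage, ← Scheme.Hom.comp_preimage, ← Over.comp_left, ← Over.comp_left]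
  exact (congrArg (fun q : G ⊗ X.X ⟶ Z => q.left ⁻¹ᵁ W) h).ge

/-- The base change `X ×_Z Z'` of an invariant morphism `π : X ⟶ Z`, with `G` acting
through `X`: `g (x, z') = (g x, z')`. -/
abbrev baseChange (X : GScheme G) {Z Z' : Over S} (π : X.X ⟶ Z) (h : X.IsInvariantHom π)
    (f : Z' ⟶ Z) : GScheme G where
  X := pullback π f
  mod :=
    { smul := pullback.lift (G ◁ pullback.fst π f ≫ X.act) (snd G _ ≫ pullback.snd π f) (by
        rw [Category.assoc, h, Category.assoc, ← pullback.condition]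
        simp [proj])
      one_smul := by
        change MonObj.one (X := G) ▷ pullback π f ≫ pullback.lift _ _ _ = (λ_ (pullback π f)).hom
        apply pullback.hom_ext
        · rw [Category.assoc, pullback.lift_fst, ← whisker_exchange_assoc, one_act,
            leftUnitor_naturality]
        · rw [Category.assoc, pullback.lift_snd]
          simp [leftUnitor_hom]
      mul_smul := by
        change MonObj.mul (X := G) ▷ pullback π f ≫ pullback.lift _ _ _ =
          (α_ G G (pullback π f)).hom ≫ G ◁ pullback.lift _ _ _ ≫ pullback.lift _ _ _
        apply pullback.hom_ext
        · simp only [Category.assoc, pullback.lift_fst]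
          rw [← whiskerLeft_comp_assoc, pullback.lift_fst, ← whisker_exchange_assoc, mul_act]
          simp
        · simp only [Category.assoc, pullback.lift_snd]
          rw [whiskerLeft_snd_assoc, pullback.lift_snd]
          simp }

/-- `π : X ⟶ Z` is a categorical quotient of `X` by `G`: it is invariant, and every invariant
morphism from `X` to an `S`-scheme factors uniquely through it. -/
def IsCategoricalQuotient (X : GScheme G) {Z : Over S} (π : X.X ⟶ Z) : Prop :=
  X.IsInvariantHom π ∧
    ∀ (T : Over S) (ψ : X.X ⟶ T), X.IsInvariantHom ψ → ∃! χ : Z ⟶ T, π ≫ χ = ψ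

/-- `π : X ⟶ Z` is a universal categorical quotient: it is invariant, and for every `Z' ⟶ Z`
the base change `X ×_Z Z' ⟶ Z'` is a categorical quotient. -/
def IsUniversalCategoricalQuotient (X : GScheme G) {Z : Over S} (π : X.X ⟶ Z) : Prop :=
  ∃ h : X.IsInvariantHom π, ∀ (Z' : Over S) (f : Z' ⟶ Z),
    (X.baseChange π h f).IsCategoricalQuotient (Z := Z') (pullback.snd π f)

/-- `π : X ⟶ Z` is a Zariski locally trivial principal `G`-bundle: it is invariant, and `Z` is
covered by opens `W i` with isomorphisms of `G`-schemes `G × W i ≅ π⁻¹(W i)` over `W i`. -/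
def IsLocallyTrivialPrincipalBundle (X : GScheme G) {Z : Over S} (π : X.X ⟶ Z) : Prop :=
  ∃ h : X.IsInvariantHom π, ∃ (I : Type u) (W : I → Z.left.Opens), (⨆ i, W i) = ⊤ ∧
    ∀ i, ∃ e : trivialGScheme G (openSub Z (W i)) ≅ X.restrict (π.left ⁻¹ᵁ W i) (h.preimage (W i)),
      e.hom.hom ≫ openIncl X.X (π.left ⁻¹ᵁ W i) ≫ π =
        snd G (openSub Z (W i)) ≫ openIncl Z (W i)

end GScheme

end

/-!
An equivariant morphism `σ : U ⟶ G` yields the idempotent `x ↦ σ(x)⁻¹ x` of `U`, which is constant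
on orbits. Its splitting is a quotient `Q` of `U`, and `x ↦ (σ(x), [x])` identifies `U` with
`G × Q`. An equivariant morphism of such trivial torsors is cartesian over the morphism of their
quotients; so an open immersion of invariant opens induces an open immersion of quotients (a base
change along the unit section), and the quotients of all trivializable invariant opens glue to a
scheme `Z` over which `X` is a locally trivial `G`-bundle.

Such a bundle presents `Z` as the Zariski sheaf quotient `X / G`. This property is stable under
base change, and it implies the universal property because the Zariski topology is subcanonical.
-/

noncomputable section

open scoped MonObj

universe v w

section Subcanonical

variable {C : Type w} [Category.{v} C] {J : GrothendieckTopology C} [J.Subcanonical] {X T : C}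

lemma hom_ext_of_covering {R : Sieve X} (hR : R ∈ J X) {f g : X ⟶ T}
    (h : ∀ ⦃Y : C⦄ (c : Y ⟶ X), R c → c ≫ f = c ≫ g) : f = g :=
  (GrothendieckTopology.Subcanonical.isSheaf_of_isRepresentable (yoneda.obj T) R
    hR).isSeparatedFor.ext fun _ c hc => h c hc

end Subcanonical

section CartesianMonoidal

variable {C : Type w} [Category.{v} C] [CartesianMonoidalCategory C] {G : C} [GrpObj G]
  {X X' : Mod C G} {T T' : C}

/-- `ψ : X ⟶ T` is constant on the orbits of `G`: it coequalizes the action and the projection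
`G ⊗ X ⟶ X`. For `G`-schemes this is `GScheme.IsInvariantHom`. -/
def OrbitConstant (X : Mod C G) (ψ : X.X ⟶ T) : Prop :=
  ModObj.smul (M := G) (X := X.X) ≫ ψ = snd G X.X ≫ ψ

lemma orbitConstant_iff_forall_smul {ψ : X.X ⟶ T} :
    OrbitConstant X ψ ↔ ∀ ⦃Y : C⦄ (g : Y ⟶ G) (x : Y ⟶ X.X), (g • x) ≫ ψ = x ≫ ψ := by
  refine ⟨fun h Y g x => ?_, fun h => ?_⟩
  · rw [Hom.smul_def, Category.assoc, h, lift_snd_assoc]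
  · simpa [Hom.smul_def, OrbitConstant] using h (fst G X.X) (snd G X.X)

namespace OrbitConstant

lemma smul_comp {ψ : X.X ⟶ T} (h : OrbitConstant X ψ) {Y : C} (g : Y ⟶ G) (x : Y ⟶ X.X) :
    (g • x) ≫ ψ = x ≫ ψ :=
  orbitConstant_iff_forall_smul.mp h g x

lemma comp {ψ : X.X ⟶ T} (h : OrbitConstant X ψ) (f : T ⟶ T') : OrbitConstant X (ψ ≫ f) := by
  rw [OrbitConstant, reassoc_of% h]

lemma hom_comp {ψ : X'.X ⟶ T} (h : OrbitConstant X' ψ) (i : X ⟶ X') :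
    OrbitConstant X (i.hom ≫ ψ) :=
  orbitConstant_iff_forall_smul.mpr fun Y g x => by
    rw [← Category.assoc, IsModHom.map_smul, h.smul_comp, Category.assoc]

end OrbitConstant

lemma isModHom_of_forall_smul {f : X.X ⟶ X'.X}
    (h : ∀ ⦃Y : C⦄ (g : Y ⟶ G) (x : Y ⟶ X.X), (g • x) ≫ f = g • x ≫ f) : IsModHom G f where
  smul_hom := by
    have := h (fst G X.X) (snd G X.X)
    rw [Hom.smul_def, Hom.smul_def, lift_fst_snd, Category.id_comp] at this
    rw [this]
    congr 1
    ext1 <;> simp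

lemma exists_iso_of_isPullback {X'' : Mod C G} {Q Z : C} {i : X ⟶ X''} {i' : X' ⟶ X''}
    {p : X.X ⟶ Q} {p' : X'.X ⟶ Q} {π : X''.X ⟶ Z} {f : Q ⟶ Z} (h : IsPullback i.hom p π f)
    (h' : IsPullback i'.hom p' π f) (hp : OrbitConstant X p) (hp' : OrbitConstant X' p') :
    ∃ e : X ≅ X', e.hom.hom ≫ i'.hom = i.hom ∧ e.hom.hom ≫ p' = p := by
  let e : X.X ≅ X'.X := h.isoIsPullback _ _ h'
  have he : e.hom ≫ i'.hom = i.hom := h.isoIsPullback_hom_fst _ _ h'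
  have he' : e.hom ≫ p' = p := h.isoIsPullback_hom_snd _ _ h'
  have : IsModHom G e.hom := isModHom_of_forall_smul fun Y g x => h'.hom_ext
    (by simp only [Category.assoc, he, IsModHom.map_smul])
    (by rw [Category.assoc, he', hp.smul_comp, hp'.smul_comp, Category.assoc, he'])
  exact ⟨⟨⟨e.hom⟩, ⟨e.inv⟩, Mod.hom_ext _ _ e.hom_inv_id, Mod.hom_ext _ _ e.inv_hom_id⟩, he, he'⟩

/-- The morphism `x ↦ σ(x)⁻¹ x`. For an equivariant `σ` it is an idempotent, constant on orbits,
which moves every point of `X` to the fibre of `σ` over `1`. -/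
def normalizeBy (σ : X.X ⟶ G) : X.X ⟶ X.X := σ⁻¹ • 𝟙 X.X

lemma comp_normalizeBy (σ : X.X ⟶ G) {Y : C} (x : Y ⟶ X.X) :
    x ≫ normalizeBy σ = (x ≫ σ)⁻¹ • x := by
  rw [normalizeBy, ModObj.comp_smul, GrpObj.comp_inv, Category.comp_id]

lemma OrbitConstant.normalizeBy_comp {ψ : X.X ⟶ T} (h : OrbitConstant X ψ) (σ : X.X ⟶ G) :
    normalizeBy σ ≫ ψ = ψ := by
  rw [normalizeBy, h.smul_comp, Category.id_comp]

lemma orbitConstant_normalizeBy {σ : X.X ⟶ G}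
    (hσ : ∀ ⦃Y : C⦄ (g : Y ⟶ G) (x : Y ⟶ X.X), (g • x) ≫ σ = g * x ≫ σ) :
    OrbitConstant X (normalizeBy σ) :=
  orbitConstant_iff_forall_smul.mpr fun Y g x => by
    rw [comp_normalizeBy, comp_normalizeBy, hσ, smul_smul, mul_inv_rev, inv_mul_cancel_right]

/-- A trivialization of `X` as a `G`-torsor over `Q`: an equivariant morphism to `G` and an
orbit-constant projection to `Q` that together identify `X` with `G ⊗ Q`. The identification is
encoded by the section `sec` of `proj`, through `x = toGroup x • sec (proj x)`. -/
structure TorsorTrivialization (X : Mod C G) (Q : C) where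
  /-- The `G`-coordinate. -/
  toGroup : X.X ⟶ G
  /-- The projection to the base. -/
  proj : X.X ⟶ Q
  /-- The unit section. -/
  sec : Q ⟶ X.X
  smul_comp_toGroup : ∀ ⦃Y : C⦄ (g : Y ⟶ G) (x : Y ⟶ X.X), (g • x) ≫ toGroup = g * x ≫ toGroup
  orbitConstant_proj : OrbitConstant X proj
  sec_proj : sec ≫ proj = 𝟙 Q
  toGroup_smul_proj_sec : toGroup • (proj ≫ sec) = 𝟙 X.X

namespace TorsorTrivialization

lemma exists_of_hom_regular [IsIdempotentComplete C] (f : X ⟶ Mod.regular G) :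
    ∃ Q : C, Nonempty (TorsorTrivialization X Q) := by
  let σ : X.X ⟶ G := f.hom
  have hσ : ∀ ⦃Y : C⦄ (g : Y ⟶ G) (x : Y ⟶ X.X), (g • x) ≫ σ = g * x ≫ σ :=
    fun Y g x => IsModHom.map_smul f.hom g x
  have h := orbitConstant_normalizeBy hσ
  obtain ⟨Q, sec, proj, sec_proj, proj_sec⟩ :=
    IsIdempotentComplete.idempotents_split X.X (normalizeBy σ) (h.normalizeBy_comp σ)
  have : Mono sec := mono_of_mono_fac sec_proj
  refine ⟨Q, ⟨σ, proj, sec, hσ, ?_, sec_proj, ?_⟩⟩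
  · rwa [OrbitConstant, ← cancel_mono sec, Category.assoc, Category.assoc, proj_sec]
  · rw [proj_sec, normalizeBy, smul_inv_smul]

variable {Q Q' : C} (t : TorsorTrivialization X Q) (t' : TorsorTrivialization X' Q')

lemma comp_toGroup_smul {Y : C} (x : Y ⟶ X.X) :
    (x ≫ t.toGroup) • (x ≫ t.proj ≫ t.sec) = x := by
  rw [← ModObj.comp_smul, toGroup_smul_proj_sec, Category.comp_id]

lemma hom_ext {Y : C} {x y : Y ⟶ X.X} (hG : x ≫ t.toGroup = y ≫ t.toGroup)
    (hQ : x ≫ t.proj = y ≫ t.proj) : x = y := by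
  rw [← t.comp_toGroup_smul x, ← t.comp_toGroup_smul y, hG, reassoc_of% hQ]

lemma epi_proj : Epi t.proj := (SplitEpi.mk t.sec t.sec_proj).epi

lemma smul_sec_proj {Y : C} (g : Y ⟶ G) (z : Y ⟶ Q) : (g • (z ≫ t.sec)) ≫ t.proj = z := by
  rw [t.orbitConstant_proj.smul_comp, Category.assoc, t.sec_proj, Category.comp_id]

lemma exists_hom (q : Q ⟶ Q') : ∃ i : X ⟶ X', i.hom ≫ t'.proj = t.proj ≫ q := by
  have : IsModHom G (t.toGroup • (t.proj ≫ q ≫ t'.sec) : X.X ⟶ X'.X) :=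
    isModHom_of_forall_smul fun Y g x => by
      rw [ModObj.comp_smul, ModObj.comp_smul, smul_smul, t.smul_comp_toGroup, ← Category.assoc,
        t.orbitConstant_proj.smul_comp, Category.assoc]
  exact ⟨⟨t.toGroup • (t.proj ≫ q ≫ t'.sec)⟩, by
    simpa only [Category.assoc] using t'.smul_sec_proj t.toGroup (t.proj ≫ q)⟩

lemma smul_hom_comp_toGroup (i : X ⟶ X') {Y : C} (g : Y ⟶ G) (x : Y ⟶ X.X) :
    (g • x) ≫ i.hom ≫ t'.toGroup = g * x ≫ i.hom ≫ t'.toGroup := by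
  rw [← Category.assoc, IsModHom.map_smul, t'.smul_comp_toGroup, Category.assoc]

lemma hom_ext_of_comp_hom (i : X ⟶ X') {Y : C} {x y : Y ⟶ X.X}
    (hi : x ≫ i.hom ≫ t'.toGroup = y ≫ i.hom ≫ t'.toGroup) (hQ : x ≫ t.proj = y ≫ t.proj) :
    x = y := by
  have comp_eq (x : Y ⟶ X.X) : x ≫ i.hom ≫ t'.toGroup =
      x ≫ t.toGroup * x ≫ t.proj ≫ t.sec ≫ i.hom ≫ t'.toGroup := by
    conv_lhs => rw [← t.comp_toGroup_smul x]
    simp only [t'.smul_hom_comp_toGroup, Category.assoc]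
  refine t.hom_ext ?_ hQ
  rw [comp_eq x, comp_eq y, reassoc_of% hQ] at hi
  exact mul_right_cancel hi

/-- A morphism of trivial torsors is determined by its values on the unit section, so that
`(x', z)` lifts to the only `g • sec z` with the same image in `G` as `x'`. -/
lemma isPullback {i : X ⟶ X'} {q : Q ⟶ Q'} (h : i.hom ≫ t'.proj = t.proj ≫ q) :
    IsPullback i.hom t.proj t'.proj q := by
  let lift (s : PullbackCone t'.proj q) : s.pt ⟶ X.X :=
    (s.fst ≫ t'.toGroup * (s.snd ≫ t.sec ≫ i.hom ≫ t'.toGroup)⁻¹) • (s.snd ≫ t.sec)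
  have lift_proj (s : PullbackCone t'.proj q) : lift s ≫ t.proj = s.snd := t.smul_sec_proj _ _
  have lift_hom (s : PullbackCone t'.proj q) : lift s ≫ i.hom = s.fst := by
    refine t'.hom_ext ?_ ?_
    · rw [Category.assoc, t'.smul_hom_comp_toGroup, Category.assoc, inv_mul_cancel_right]
    · rw [Category.assoc, h, reassoc_of% lift_proj, s.condition]
  exact ⟨⟨h⟩, ⟨PullbackCone.IsLimit.mk _ lift lift_hom lift_proj fun s m hm hm' =>
    t.hom_ext_of_comp_hom t' i (by rw [reassoc_of% hm, reassoc_of% lift_hom])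
      (hm'.trans (lift_proj s).symm)⟩⟩

/-- The morphism of quotients induced by an equivariant morphism of trivial torsors, computed
through the unit section. -/
def quotientMap (i : X ⟶ X') : Q ⟶ Q' := t.sec ≫ i.hom ≫ t'.proj

lemma proj_quotientMap (i : X ⟶ X') : t.proj ≫ t.quotientMap t' i = i.hom ≫ t'.proj := by
  conv_rhs => rw [← Category.id_comp i.hom, ← t.toGroup_smul_proj_sec]
  rw [Category.assoc, (t'.orbitConstant_proj.hom_comp i).smul_comp, Category.assoc, quotientMap]

lemma isPullback_quotientMap (i : X ⟶ X') :
    IsPullback i.hom t.proj t'.proj (t.quotientMap t' i) :=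
  t.isPullback t' (t.proj_quotientMap t' i).symm

lemma exists_isPullback_quotientMap_sec (i : X ⟶ X') :
    ∃ s : Q ⟶ X.X, IsPullback s (t.quotientMap t' i) i.hom t'.sec := by
  have h := t.isPullback_quotientMap t' i
  let s := h.lift (t.quotientMap t' i ≫ t'.sec) (𝟙 Q) (by simp [t'.sec_proj])
  refine ⟨s, IsPullback.of_right ?_ (h.lift_fst _ _ _) h.flip⟩
  rw [h.lift_snd, t'.sec_proj]
  exact IsPullback.of_horiz_isIso ⟨by simp⟩

section quotientFunctor

variable {I : Type*} [Category I] (F : I ⥤ Mod C G) {Q : I → C}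
  (t : ∀ i, TorsorTrivialization (F.obj i) (Q i))

/-- The quotients of a diagram of trivial torsors. -/
def quotientFunctor : I ⥤ C where
  obj := Q
  map f := (t _).quotientMap (t _) (F.map f)
  map_id i := by
    have := (t i).epi_proj
    rw [← cancel_epi (t i).proj, proj_quotientMap]
    simp
  map_comp {i j k} f g := by
    have := (t i).epi_proj
    rw [← cancel_epi (t i).proj, reassoc_of% (t i).proj_quotientMap (t j), proj_quotientMap,
      proj_quotientMap]
    simp

/-- The projections of a diagram of trivial torsors to its diagram of quotients. -/
def toQuotientFunctor : F ⋙ Mod.forget G ⟶ quotientFunctor F t where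
  app i := (t i).proj
  naturality _ _ f := ((t _).proj_quotientMap (t _) (F.map f)).symm

lemma equifibered_toQuotientFunctor : (toQuotientFunctor F t).Equifibered :=
  fun _ _ f => (t _).isPullback_quotientMap (t _) (F.map f)

end quotientFunctor

end TorsorTrivialization

section SheafQuotient

variable (J : GrothendieckTopology C)

/-- The sieve of those `c` after which some element of `G` carries the point `a` of `X` to the
point `b`. -/
def transporter (X : Mod C G) {Y : C} (a b : Y ⟶ X.X) : Sieve Y where
  arrows Y' c := ∃ g : Y' ⟶ G, g • (c ≫ a) = c ≫ b
  downward_closed := by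
    rintro _ _ c ⟨g, hg⟩ d
    exact ⟨d ≫ g, by rw [Category.assoc, Category.assoc, ← hg, ModObj.comp_smul]⟩

/-- `π : X ⟶ Z` presents `Z` as the sheaf quotient `X / G` for the topology `J`: it is constant on
orbits, `J`-locally surjective, and two points of `X` with the same image are `J`-locally in the
same orbit. -/
structure IsSheafQuotient (X : Mod C G) {Z : C} (π : X.X ⟶ Z) : Prop where
  orbitConstant : OrbitConstant X π
  generate_mem : Sieve.generate (Presieve.singleton π) ∈ J Z
  transporter_mem : ∀ ⦃Y : C⦄ (a b : Y ⟶ X.X), a ≫ π = b ≫ π → transporter X a b ∈ J Y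

variable {J}

lemma OrbitConstant.of_ofArrows_covering [J.Subcanonical] {I : Type*} {U : I → Mod C G}
    {j : ∀ i, U i ⟶ X} (hj : Sieve.ofArrows _ (fun i => (j i).hom) ∈ J X.X) {ψ : X.X ⟶ T}
    (h : ∀ i, OrbitConstant (U i) ((j i).hom ≫ ψ)) : OrbitConstant X ψ :=
  orbitConstant_iff_forall_smul.mpr fun Y g x => by
    refine hom_ext_of_covering (J.pullback_stable x hj) fun Y' c hc => ?_
    obtain ⟨_, u, _, ⟨i⟩, hu⟩ := hc
    rw [← Category.assoc, ModObj.comp_smul, ← hu, ← IsModHom.map_smul, Category.assoc,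
      (h i).smul_comp, ← Category.assoc, hu, Category.assoc]

namespace IsSheafQuotient

variable {Z : C} {π : X.X ⟶ Z}

lemma existsUnique_comp_eq [J.Subcanonical] (h : IsSheafQuotient J X π) {ψ : X.X ⟶ T}
    (hψ : OrbitConstant X ψ) : ∃! χ : Z ⟶ T, π ≫ χ = ψ := by
  have hT : Presieve.IsSheafFor (yoneda.obj T) (Presieve.singleton π) :=
    (GrothendieckTopology.Subcanonical.isSheaf_of_isRepresentable (yoneda.obj T)).isSheafFor _
      h.generate_mem
  refine Presieve.isSheafFor_singleton.mp hT ψ fun a b hab => ?_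
  refine hom_ext_of_covering (h.transporter_mem a b hab) fun _ c ⟨g, hg⟩ => ?_
  change c ≫ a ≫ ψ = c ≫ b ≫ ψ
  rw [← Category.assoc c b, ← hg, hψ.smul_comp, Category.assoc]

lemma of_isPullback (h : IsSheafQuotient J X π) {Z' : C} {i : X' ⟶ X} {π' : X'.X ⟶ Z'}
    {f : Z' ⟶ Z} (hi : IsPullback i.hom π' π f) (hπ' : OrbitConstant X' π') :
    IsSheafQuotient J X' π' where
  orbitConstant := hπ'
  generate_mem := by
    refine J.superset_covering ?_ (J.pullback_stable f h.generate_mem)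
    rintro Y c ⟨_, x, _, ⟨⟩, hx⟩
    exact ⟨_, hi.lift x c hx, π', ⟨⟩, hi.lift_snd _ _ _⟩
  transporter_mem Y a b hab := by
    have hab' : (a ≫ i.hom) ≫ π = (b ≫ i.hom) ≫ π := by
      rw [Category.assoc, Category.assoc, hi.w, reassoc_of% hab]
    refine J.superset_covering ?_ (h.transporter_mem _ _ hab')
    rintro Y' c ⟨g, hg⟩
    refine ⟨g, hi.hom_ext ?_ ?_⟩
    · rw [IsModHom.map_smul, Category.assoc, hg, Category.assoc]
    · rw [hπ'.smul_comp, Category.assoc, hab, Category.assoc]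

lemma of_ofArrows_covering {I : Type*} {W : I → C} {f : ∀ i, W i ⟶ Z}
    (hf : Sieve.ofArrows W f ∈ J Z) {U : I → Mod C G} {j : ∀ i, U i ⟶ X} {p : ∀ i, (U i).X ⟶ W i}
    (hj : ∀ i, IsPullback (j i).hom (p i) π (f i)) (hp : ∀ i, IsSheafQuotient J (U i) (p i))
    (hπ : OrbitConstant X π) : IsSheafQuotient J X π where
  orbitConstant := hπ
  generate_mem := by
    refine J.transitive hf _ ?_
    rintro Y _ ⟨_, u, _, ⟨i⟩, rfl⟩
    rw [Sieve.pullback_comp]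
    refine J.pullback_stable u (J.superset_covering ?_ (hp i).generate_mem)
    rintro Y' _ ⟨_, x, _, ⟨⟩, rfl⟩
    exact ⟨_, x ≫ (j i).hom, _, ⟨⟩, by simp only [Category.assoc, (hj i).w]⟩
  transporter_mem Y a b hab := by
    refine J.transitive (J.pullback_stable (a ≫ π) hf) _ ?_
    rintro Y' c ⟨_, u, _, ⟨i⟩, hu⟩
    have hb : (c ≫ b) ≫ π = u ≫ f i := by rw [hu, Category.assoc, hab]
    let a' := (hj i).lift (c ≫ a) u (by rw [hu, Category.assoc])
    let b' := (hj i).lift (c ≫ b) u hb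
    have hab' : a' ≫ p i = b' ≫ p i := by rw [(hj i).lift_snd, (hj i).lift_snd]
    refine J.superset_covering ?_ ((hp i).transporter_mem a' b' hab')
    rintro Y'' d ⟨g, hg⟩
    refine ⟨g, ?_⟩
    have := congr($hg ≫ (j i).hom)
    simpa [IsModHom.map_smul, a', b'] using this

end IsSheafQuotient

lemma TorsorTrivialization.isSheafQuotient {Q : C} (t : TorsorTrivialization X Q) :
    IsSheafQuotient J X t.proj where
  orbitConstant := t.orbitConstant_proj
  generate_mem := by
    refine J.covering_of_eq_top (Sieve.id_mem_iff_eq_top.mp ?_)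
    exact ⟨_, t.sec, _, ⟨⟩, t.sec_proj⟩
  transporter_mem Y a b hab := by
    refine J.covering_of_eq_top (Sieve.id_mem_iff_eq_top.mp
      ⟨(b ≫ t.toGroup) * (a ≫ t.toGroup)⁻¹, t.hom_ext ?_ ?_⟩)
    · rw [t.smul_comp_toGroup, Category.id_comp, Category.id_comp, inv_mul_cancel_right]
    · rw [t.orbitConstant_proj.smul_comp, Category.id_comp, Category.id_comp, hab]

end SheafQuotient

end CartesianMonoidal

namespace GScheme

variable {S : Scheme.{u}} {G : Over S} [GrpObj G]

lemma ofArrows_openIncl_covering {Z : Over S} {I : Type*} {W : I → Z.left.Opens}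
    (hW : (⨆ i, W i) = ⊤) :
    Sieve.ofArrows _ (fun i => openIncl Z (W i)) ∈ Scheme.zariskiTopology.over S Z := by
  rw [GrothendieckTopology.mem_over_iff, Sieve.overEquiv_ofArrows]
  exact (Z.left.openCoverOfIsOpenCover W hW).mem_grothendieckTopology

lemma isPullback_of_isPullback_left {W X Y Z : Over S} {f : W ⟶ X} {g : W ⟶ Y} {h : X ⟶ Z}
    {k : Y ⟶ Z} (H : IsPullback f.left g.left h.left k.left) : IsPullback f g h k :=
  IsPullback.of_map (Over.forget S) (by ext1; exact H.w) H

/-- The equivariant inclusion of an invariant open subscheme. -/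
def restrictIncl (X : GScheme G) {U : X.X.left.Opens} (hU : X.IsInvariant U) :
    X.restrict U hU ⟶ X :=
  Mod.Hom.mk' (M := X.restrict U hU) (openIncl X.X U) (X.restrictAct_incl U hU)

/-- The equivariant projection of a base change to the original `G`-scheme. -/
def baseChangeFst (X : GScheme G) {Z Z' : Over S} {π : X.X ⟶ Z} (h : X.IsInvariantHom π)
    (f : Z' ⟶ Z) : X.baseChange π h f ⟶ X :=
  Mod.Hom.mk' (M := X.baseChange π h f) (pullback.fst π f) (pullback.lift_fst _ _ _)

lemma isInvariantHom_baseChange_snd (X : GScheme G) {Z Z' : Over S} {π : X.X ⟶ Z}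
    (h : X.IsInvariantHom π) (f : Z' ⟶ Z) :
    (X.baseChange π h f).IsInvariantHom (pullback.snd π f) :=
  pullback.lift_snd _ _ _

lemma comp_trivialGScheme_act {W Y : Over S} (g : Y ⟶ G) (x : Y ⟶ G ⊗ W) :
    lift g x ≫ (trivialGScheme G W).act = lift (g * x ≫ fst G W) (x ≫ snd G W) := by
  change lift g x ≫ (α_ G G W).inv ≫ MonObj.mul (X := G) ▷ W = _
  have : lift g x ≫ (α_ G G W).inv = lift (lift g (x ≫ fst G W)) (x ≫ snd G W) := by
    ext1
    · ext1 <;> simp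
    · simp
  rw [reassoc_of% this, lift_whiskerRight, Hom.mul_def]

/-- The product `G × W` as a trivialized torsor over `W`. -/
def trivialization (G W : Over S) [GrpObj G] : TorsorTrivialization (trivialGScheme G W) W where
  toGroup := fst G W
  proj := snd G W
  sec := lift 1 (𝟙 W)
  smul_comp_toGroup Y g x := by
    change (lift g x ≫ (trivialGScheme G W).act) ≫ fst G W = _
    rw [comp_trivialGScheme_act, lift_fst]
  orbitConstant_proj := orbitConstant_iff_forall_smul.mpr fun Y g x => by
    change (lift g x ≫ (trivialGScheme G W).act) ≫ snd G W = _
    rw [comp_trivialGScheme_act, lift_snd]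
  sec_proj := lift_snd _ _
  toGroup_smul_proj_sec := by
    change lift (fst G W) (snd G W ≫ lift 1 (𝟙 W)) ≫ (trivialGScheme G W).act = _
    rw [comp_trivialGScheme_act]
    ext1 <;> simp [MonObj.comp_one]

/-- The morphism `π⁻¹(W) ⟶ W` induced by `π` over the base. -/
def restrictPreimage {X Z : Over S} (π : X ⟶ Z) (W : Z.left.Opens) :
    openSub X (π.left ⁻¹ᵁ W) ⟶ openSub Z W :=
  Over.homMk (π.left ∣_ W)

lemma isPullback_restrictPreimage {X Z : Over S} (π : X ⟶ Z) (W : Z.left.Opens) :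
    IsPullback (openIncl X (π.left ⁻¹ᵁ W)) (restrictPreimage π W) π (openIncl Z W) :=
  isPullback_of_isPullback_left (isPullback_morphismRestrict π.left W).flip

section PreimageOfOpen

variable {X : GScheme G} {Z : Over S} {π : X.X ⟶ Z} (h : X.IsInvariantHom π) (W : Z.left.Opens)

lemma IsInvariantHom.orbitConstant_restrictPreimage :
    OrbitConstant (X.restrict (π.left ⁻¹ᵁ W) (h.preimage W)) (restrictPreimage π W) :=
  orbitConstant_iff_forall_smul.mpr fun Y g x => by
    have hW := (isPullback_restrictPreimage π W).w
    have hx := (OrbitConstant.hom_comp h (X.restrictIncl (h.preimage W))).smul_comp g x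
    rw [← cancel_mono (openIncl Z W), Category.assoc, Category.assoc, ← hW]
    exact hx

lemma exists_isPullback_of_iso_restrict
    (e : trivialGScheme G (openSub Z W) ≅ X.restrict (π.left ⁻¹ᵁ W) (h.preimage W))
    (he : e.hom.hom ≫ openIncl X.X (π.left ⁻¹ᵁ W) ≫ π =
      snd G (openSub Z W) ≫ openIncl Z W) :
    ∃ φ : trivialGScheme G (openSub Z W) ⟶ X,
      IsPullback φ.hom (snd G (openSub Z W)) π (openIncl Z W) := by
  have hW := isPullback_restrictPreimage π W
  have : IsIso e.hom.hom := ((Mod.forget G).mapIso e).isIso_hom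
  have he' : e.hom.hom ≫ restrictPreimage π W = snd G (openSub Z W) := by
    rw [← cancel_mono (openIncl Z W), Category.assoc, ← hW.w, he]
  have := (IsPullback.of_horiz_isIso (snd := snd G (openSub Z W)) (g := 𝟙 _)
    ⟨he'.trans (Category.comp_id _).symm⟩).paste_horiz hW
  rw [Category.id_comp] at this
  exact ⟨e.hom ≫ X.restrictIncl _, this⟩

lemma exists_iso_restrict_of_isPullback {φ : trivialGScheme G (openSub Z W) ⟶ X}
    (hφ : IsPullback φ.hom (snd G (openSub Z W)) π (openIncl Z W)) :
    ∃ e : trivialGScheme G (openSub Z W) ≅ X.restrict (π.left ⁻¹ᵁ W) (h.preimage W),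
      e.hom.hom ≫ openIncl X.X (π.left ⁻¹ᵁ W) ≫ π = snd G (openSub Z W) ≫ openIncl Z W := by
  obtain ⟨e, he, -⟩ := exists_iso_of_isPullback (i' := X.restrictIncl (h.preimage W)) hφ
    (isPullback_restrictPreimage π W) (trivialization G _).orbitConstant_proj
    (h.orbitConstant_restrictPreimage W)
  have he : e.hom.hom ≫ openIncl X.X (π.left ⁻¹ᵁ W) = φ.hom := he
  exact ⟨e, by rw [reassoc_of% he, hφ.w]⟩

end PreimageOfOpen

lemma IsLocallyTrivialPrincipalBundle.isSheafQuotient {X : GScheme G} {Z : Over S} {π : X.X ⟶ Z}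
    (h : X.IsLocallyTrivialPrincipalBundle π) :
    IsSheafQuotient (Scheme.zariskiTopology.over S) X π := by
  obtain ⟨hπ, I, W, hW, hX⟩ := h
  choose e he using hX
  choose φ hφ using fun i => exists_isPullback_of_iso_restrict hπ (W i) (e i) (he i)
  exact .of_ofArrows_covering (ofArrows_openIncl_covering hW) hφ
    (fun i => (trivialization G (openSub Z (W i))).isSheafQuotient) hπ

lemma isUniversalCategoricalQuotient_of_isSheafQuotient {X : GScheme G} {Z : Over S} {π : X.X ⟶ Z}
    (h : IsSheafQuotient (Scheme.zariskiTopology.over S) X π) :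
    X.IsUniversalCategoricalQuotient π := by
  refine ⟨h.orbitConstant, fun Z' f => ?_⟩
  have hπ' := X.isInvariantHom_baseChange_snd h.orbitConstant f
  have h' := h.of_isPullback (i := X.baseChangeFst h.orbitConstant f)
    (IsPullback.of_hasPullback π f) hπ'
  exact ⟨hπ', fun T ψ hψ => h'.existsUnique_comp_eq hψ⟩

end GScheme

section Gluing

variable {J : Type*} [Category J] {F Q : J ⥤ Scheme.{u}} {s : F ⟶ Q}

lemma isLocallyDirected_of_equifibered_of_surjective (hs : s.Equifibered)
    [∀ i, Surjective (s.app i)] [(F ⋙ Scheme.forget).IsLocallyDirected] :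
    (Q ⋙ Scheme.forget).IsLocallyDirected where
  cond {i j k} fi fj xi xj h := by
    obtain ⟨yi, rfl⟩ := (s.app i).surjective xi
    have h : s.app k (F.map fi yi) = Q.map fj xj := by
      rw [← Scheme.Hom.comp_apply, s.naturality]
      exact h
    obtain ⟨yj, hyj, rfl⟩ := Scheme.exists_preimage_of_isPullback (hs fj) (F.map fi yi) xj h
    obtain ⟨l, fli, flj, z, rfl, rfl⟩ :=
      (F ⋙ Scheme.forget).exists_map_eq_of_isLocallyDirected fi fj yi yj hyj.symm
    refine ⟨l, fli, flj, s.app l z, ?_, ?_⟩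
    · exact congr($(s.naturality fli) z).symm
    · exact congr($(s.naturality flj) z).symm

variable [Quiver.IsThin J] [Small.{u} J] [∀ {i j} (f : i ⟶ j), IsOpenImmersion (Q.map f)]
  [(Q ⋙ Scheme.forget).IsLocallyDirected]

/-- A point of the cocone that `π` maps into `Q i` comes from some `F j`; its image in `Q j`
lies in some `Q k` below both `Q i` and `Q j`, so by equifiberedness it comes from `F k`. -/
lemma preimage_opensRange_ι_of_equifibered (hs : s.Equifibered) {c : Cocone F}
    [∀ i, IsOpenImmersion (c.ι.app i)] (hc : ∀ x : c.pt, ∃ i y, c.ι.app i y = x)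
    {π : c.pt ⟶ colimit Q} (hπ : ∀ i, c.ι.app i ≫ π = s.app i ≫ colimit.ι Q i) (i : J) :
    π ⁻¹ᵁ (colimit.ι Q i).opensRange = (c.ι.app i).opensRange := by
  have hπ_apply (j : J) (y : F.obj j) : π (c.ι.app j y) = colimit.ι Q j (s.app j y) :=
    congr($(hπ j) y)
  ext x
  constructor
  · rintro ⟨q, hq⟩
    obtain ⟨j, y, rfl⟩ := hc x
    obtain ⟨k, fi, fj, w, -, hw⟩ :=
      (Scheme.IsLocallyDirected.ι_eq_ι_iff Q).mp (hq.trans (hπ_apply j y))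
    obtain ⟨z, rfl, -⟩ := Scheme.exists_preimage_of_isPullback (hs fj) y w hw.symm
    exact ⟨F.map fi z, by
      rw [← Scheme.Hom.comp_apply, ← Scheme.Hom.comp_apply, c.w, c.w]⟩
  · rintro ⟨y, rfl⟩
    exact ⟨s.app i y, (hπ_apply i y).symm⟩

lemma isPullback_colimit_ι_of_equifibered (hs : s.Equifibered) {c : Cocone F}
    [∀ i, IsOpenImmersion (c.ι.app i)] (hc : ∀ x : c.pt, ∃ i y, c.ι.app i y = x)
    {π : c.pt ⟶ colimit Q} (hπ : ∀ i, c.ι.app i ≫ π = s.app i ≫ colimit.ι Q i) (i : J) :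
    IsPullback (c.ι.app i) (s.app i) π (colimit.ι Q i) :=
  (IsOpenImmersion.isPullback _ _ _ _ (hπ i)
    (preimage_opensRange_ι_of_equifibered hs hc hπ i)).flip

end Gluing

section InfClosedCover

variable {X : Scheme.{u}}

lemma exists_pullback_lift_homOfLE_eq {U V W : X.Opens} (hU : W ≤ U) (hV : W ≤ V) (h : U ⊓ V ≤ W)
    (x : ↥(pullback U.ι V.ι)) :
    ∃ y, pullback.lift (X.homOfLE hU) (X.homOfLE hV) (by simp) y = x := by
  obtain ⟨y, hy⟩ : ∃ y, W.ι y = (pullback.fst U.ι V.ι ≫ U.ι) x := by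
    refine ⟨⟨_, h ⟨(pullback.fst U.ι V.ι x).2, ?_⟩⟩, rfl⟩
    change (pullback.fst U.ι V.ι ≫ U.ι) x ∈ V
    rw [pullback.condition]
    exact (pullback.snd U.ι V.ι x).2
  refine ⟨y, (pullback.fst U.ι V.ι ≫ U.ι).isOpenEmbedding.injective ?_⟩
  rw [← Scheme.Hom.comp_apply, pullback.lift_fst_assoc, X.homOfLE_ι, hy]

variable {I : Type u} [SemilatticeInf I] (U : InfHom I X.Opens) (hU : (⨆ i, U i) = ⊤)

/-- The open cover given by a family of open subschemes that is closed under intersections. -/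
abbrev infClosedCover : X.OpenCover := X.openCoverOfIsOpenCover U hU

instance : SemilatticeInf (infClosedCover U hU).I₀ := inferInstanceAs (SemilatticeInf I)

instance : Scheme.Cover.LocallyDirected (infClosedCover U hU) where
  trans f := X.homOfLE (OrderHomClass.mono U (leOfHom f))
  trans_id _ := X.homOfLE_rfl _
  trans_comp _ _ := (X.homOfLE_homOfLE _ _).symm
  w _ := X.homOfLE_ι _
  directed {i j} x := ⟨i ⊓ j, homOfLE inf_le_left, homOfLE inf_le_right,
    exists_pullback_lift_homOfLE_eq _ _ (U.map_inf' i j).ge x⟩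
  property_trans f :=
    inferInstanceAs (IsOpenImmersion (X.homOfLE (OrderHomClass.mono U (leOfHom f))))

end InfClosedCover

namespace GScheme

variable {S : Scheme.{u}} {G : Over S} [GrpObj G]

lemma IsInvariant.inf {X : GScheme G} {U V : X.X.left.Opens} (hU : X.IsInvariant U)
    (hV : X.IsInvariant V) : X.IsInvariant (U ⊓ V) :=
  inf_le_inf hU hV

/-- The equivariant inclusion of an invariant open subscheme in a larger one. -/
def restrictHomOfLE (X : GScheme G) {U V : X.X.left.Opens} (hU : X.IsInvariant U)
    (hV : X.IsInvariant V) (h : U ≤ V) : X.restrict U hU ⟶ X.restrict V hV :=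
  let i : openSub X.X U ⟶ openSub X.X V := Over.homMk (X.X.left.homOfLE h)
  have hi : i ≫ openIncl X.X V = openIncl X.X U := by ext1; exact X.X.left.homOfLE_ι h
  Mod.Hom.mk' (M := X.restrict U hU) (N := X.restrict V hV) i <| by
    change X.restrictAct U hU ≫ i = G ◁ i ≫ X.restrictAct V hV
    rw [← cancel_mono (openIncl X.X V), Category.assoc, Category.assoc, hi, restrictAct_incl,
      restrictAct_incl, ← whiskerLeft_comp_assoc, hi]

lemma exists_iso_openSub_opensRange {Y Z : Over S} (f : Y ⟶ Z) [IsOpenImmersion f.left] :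
    ∃ e : Y ≅ openSub Z f.left.opensRange, e.hom ≫ openIncl Z f.left.opensRange = f := by
  have h : f.left.isoOpensRange.hom ≫ f.left.opensRange.ι = f.left := f.left.isoOpensRange_hom_ι
  have h' : f.left.isoOpensRange.hom ≫ (openSub Z f.left.opensRange).hom = Y.hom := by
    change _ ≫ _ ≫ _ = _
    rw [reassoc_of% h, Over.w]
  exact ⟨Over.isoMk f.left.isoOpensRange h', Over.OverMorphism.ext h⟩

lemma exists_isPullback_of_isOpenImmersion {X X' : GScheme G} {i : X' ⟶ X} {Q Z : Over S}
    (t : TorsorTrivialization X' Q) {π : X.X ⟶ Z} {f : Q ⟶ Z} [IsOpenImmersion f.left]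
    (h : IsPullback i.hom t.proj π f) :
    ∃ φ : trivialGScheme G (openSub Z f.left.opensRange) ⟶ X,
      IsPullback φ.hom (snd G (openSub Z f.left.opensRange)) π
        (openIncl Z f.left.opensRange) := by
  obtain ⟨e, he⟩ := exists_iso_openSub_opensRange f
  let t₀ := trivialization G (openSub Z f.left.opensRange)
  obtain ⟨j, hj⟩ := t₀.exists_hom t e.inv
  have := (t₀.isPullback t hj).paste_horiz h
  rw [(Iso.inv_comp_eq e).mpr he.symm] at this
  exact ⟨j ≫ i, this⟩

/-- The invariant open subschemes of `X` that admit an equivariant morphism to `G`. They are the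
pieces whose quotients are glued. -/
def TrivializableOpens (X : GScheme G) : Type u :=
  {U : X.X.left.Opens // ∃ h : X.IsInvariant U, Nonempty (X.restrict U h ⟶ leftMul G)}

namespace TrivializableOpens

variable (X : GScheme G)

instance : SemilatticeInf X.TrivializableOpens :=
  Subtype.semilatticeInf fun _ _ ⟨hU, ⟨f⟩⟩ ⟨hV, _⟩ =>
    ⟨hU.inf hV, ⟨X.restrictHomOfLE (hU.inf hV) hU inf_le_left ≫ f⟩⟩

/-- The open subscheme underlying an element of `TrivializableOpens X`. -/
def toOpens : InfHom X.TrivializableOpens X.X.left.Opens := ⟨Subtype.val, fun _ _ => rfl⟩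

variable {X} in
lemma isInvariant (U : X.TrivializableOpens) : X.IsInvariant (toOpens X U) := U.2.1

/-- The diagram of the trivializable open subschemes of `X`, with their actions of `G`. -/
def diagram : X.TrivializableOpens ⥤ GScheme G where
  obj U := X.restrict (toOpens X U) U.isInvariant
  map {U V} f := X.restrictHomOfLE U.isInvariant V.isInvariant (leOfHom f)
  map_id _ := Mod.hom_ext _ _ (Over.OverMorphism.ext (X.X.left.homOfLE_rfl _))
  map_comp f g := Mod.hom_ext _ _ (Over.OverMorphism.ext
    (X.X.left.homOfLE_homOfLE (leOfHom f) (leOfHom g)).symm)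

variable {X}

lemma exists_torsorTrivialization (U : X.TrivializableOpens) :
    ∃ Q : Over S, Nonempty (TorsorTrivialization ((diagram X).obj U) Q) :=
  have : IsIdempotentComplete (Over S) :=
    (Idempotents.isIdempotentComplete_iff_hasEqualizer_of_id_and_idempotent _).mpr
      fun _ _ _ => inferInstance
  TorsorTrivialization.exists_of_hom_regular U.2.2.some

/-- The inclusions of the trivializable open subschemes in `X`, as a cocone of schemes. -/
abbrev inclusions : Cocone ((diagram X ⋙ Mod.forget G) ⋙ Over.forget S) :=
  ⟨X.X.left, ⟨fun U => (toOpens X U).ι, fun _ _ f => X.X.left.homOfLE_ι (leOfHom f)⟩⟩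

variable {Q : X.TrivializableOpens → Over S}
  (t : ∀ U, TorsorTrivialization ((diagram X).obj U) (Q U))

/-- The diagram of the quotients of the trivializable open subschemes, as schemes. -/
abbrev quotientDiagram : X.TrivializableOpens ⥤ Scheme.{u} :=
  TorsorTrivialization.quotientFunctor (diagram X) t ⋙ Over.forget S

/-- The projections of the trivializable open subschemes to their quotients. -/
abbrev projections : (diagram X ⋙ Mod.forget G) ⋙ Over.forget S ⟶ quotientDiagram t :=
  Functor.whiskerRight (TorsorTrivialization.toQuotientFunctor (diagram X) t) (Over.forget S)

lemma equifibered_projections : (projections t).Equifibered :=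
  (TorsorTrivialization.equifibered_toQuotientFunctor (diagram X) t).whiskerRight _

instance (U : X.TrivializableOpens) : Surjective ((projections t).app U) where
  surj z := ⟨(t U).sec.left z, congr($((t U).sec_proj).left z)⟩

instance {U V : X.TrivializableOpens} (f : U ⟶ V) : IsOpenImmersion ((quotientDiagram t).map f) :=
  have ⟨_, h⟩ := (t U).exists_isPullback_quotientMap_sec (t V) ((diagram X).map f)
  MorphismProperty.of_isPullback (P := @IsOpenImmersion) (h.map (Over.forget S))
    (inferInstanceAs (IsOpenImmersion (X.X.left.homOfLE (leOfHom f))))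

lemma isLocallyDirected_quotientDiagram (hX : (⨆ U, toOpens X U) = ⊤) :
    (quotientDiagram t ⋙ Scheme.forget).IsLocallyDirected :=
  have : (((diagram X ⋙ Mod.forget G) ⋙ Over.forget S) ⋙ Scheme.forget).IsLocallyDirected :=
    inferInstanceAs ((infClosedCover (toOpens X) hX).functorOfLocallyDirected ⋙
      Scheme.forget).IsLocallyDirected
  isLocallyDirected_of_equifibered_of_surjective (equifibered_projections t)

variable [(quotientDiagram t ⋙ Scheme.forget).IsLocallyDirected]

/-- The scheme glued from the quotients of the trivializable open subschemes. -/
def quotient : Over S :=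
  Over.mk (colimit.desc (quotientDiagram t)
    ⟨S, ⟨fun U => (Q U).hom, fun _ _ _ => (Over.w _).trans (Category.comp_id _).symm⟩⟩)

/-- The inclusion of the quotient of a trivializable open subscheme. -/
def toQuotient (U : X.TrivializableOpens) : Q U ⟶ quotient t :=
  Over.homMk (colimit.ι (quotientDiagram t) U) (colimit.ι_desc _ _)

instance (U : X.TrivializableOpens) : IsOpenImmersion (toQuotient t U).left :=
  inferInstanceAs (IsOpenImmersion (colimit.ι (quotientDiagram t) U))

lemma iSup_opensRange_toQuotient : (⨆ U, (toQuotient t U).left.opensRange) = ⊤ := by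
  refine top_le_iff.mp fun z _ => ?_
  obtain ⟨U, y, hy⟩ := Scheme.IsLocallyDirected.ι_jointly_surjective (quotientDiagram t) z
  exact TopologicalSpace.Opens.mem_iSup.mpr ⟨U, y, hy⟩

lemma exists_hom_quotient (hX : (⨆ U, toOpens X U) = ⊤) : ∃ π : X.X ⟶ quotient t,
    ∀ U, openIncl X.X (toOpens X U) ≫ π = (t U).proj ≫ toQuotient t U := by
  let s (U : X.TrivializableOpens) := (t U).proj ≫ toQuotient t U
  let 𝒰 := infClosedCover (toOpens X) hX
  refine ⟨𝒰.glueMorphismsOverOfLocallyDirected (fun U => (s U).left) (fun {U V} f => ?_)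
    fun U => Over.w (s U), fun U => ?_⟩
  · exact ((projections t).naturality_assoc f (colimit.ι (quotientDiagram t) V)).trans
      congr((t U).proj.left ≫ $(colimit.w (quotientDiagram t) f))
  · ext1
    exact 𝒰.map_glueMorphismsOverOfLocallyDirected_left _ _ _ U

section

variable {t} (hX : (⨆ U, toOpens X U) = ⊤) {π : X.X ⟶ quotient t}
  (hπ : ∀ U, openIncl X.X (toOpens X U) ≫ π = (t U).proj ≫ toQuotient t U)

include hX hπ

lemma isPullback_toQuotient (U : X.TrivializableOpens) :
    IsPullback (openIncl X.X (toOpens X U)) (t U).proj π (toQuotient t U) := by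
  have (V : X.TrivializableOpens) : IsOpenImmersion ((inclusions (X := X)).ι.app V) :=
    inferInstanceAs (IsOpenImmersion (toOpens X V).ι)
  refine isPullback_of_isPullback_left (isPullback_colimit_ι_of_equifibered
    (equifibered_projections t) (c := inclusions) (fun x => ?_) (fun V => congr($(hπ V).left)) U)
  obtain ⟨V, hx⟩ := TopologicalSpace.Opens.mem_iSup.mp (hX.ge (Set.mem_univ x))
  exact ⟨V, ⟨x, hx⟩, rfl⟩

lemma orbitConstant_hom_quotient : OrbitConstant X π :=
  .of_ofArrows_covering (j := fun U : X.TrivializableOpens => X.restrictIncl U.isInvariant)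
    (ofArrows_openIncl_covering hX) fun U => by
      have h := (t U).orbitConstant_proj.comp (toQuotient t U)
      rwa [← hπ U] at h

lemma isLocallyTrivialPrincipalBundle : X.IsLocallyTrivialPrincipalBundle π := by
  have h : X.IsInvariantHom π := orbitConstant_hom_quotient hX hπ
  refine ⟨h, _, fun U => (toQuotient t U).left.opensRange, iSup_opensRange_toQuotient t,
    fun U => ?_⟩
  obtain ⟨φ, hφ⟩ := exists_isPullback_of_isOpenImmersion (i := X.restrictIncl U.isInvariant) (t U)
    (isPullback_toQuotient hX hπ U)
  exact exists_iso_restrict_of_isPullback h _ hφ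

end

lemma exists_isLocallyTrivialPrincipalBundle (hX : (⨆ U, toOpens X U) = ⊤) :
    ∃ (Z : Over S) (π : X.X ⟶ Z), X.IsLocallyTrivialPrincipalBundle π := by
  choose Q t using exists_torsorTrivialization (X := X)
  replace t U := (t U).some
  have := isLocallyDirected_quotientDiagram t hX
  obtain ⟨π, hπ⟩ := exists_hom_quotient t hX
  exact ⟨quotient t, π, isLocallyTrivialPrincipalBundle hX hπ⟩

end TrivializableOpens

end GScheme

end

theorem mainTheorem8_general {S : Scheme.{u}} (G : Over S) [GrpObj G] (X : GScheme G) {I : Type*}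
    (U : I → X.X.left.Opens) (hcover : (⨆ i, U i) = ⊤) (hinv : ∀ i, X.IsInvariant (U i))
    (hσ : ∀ i, Nonempty (X.restrict (U i) (hinv i) ⟶ GScheme.leftMul G)) :
    ∃ (Z : Over S) (π : X.X ⟶ Z),
      X.IsUniversalCategoricalQuotient π ∧ X.IsLocallyTrivialPrincipalBundle π := by
  have hX : (⨆ V, GScheme.TrivializableOpens.toOpens X V) = ⊤ :=
    top_le_iff.mp <| hcover ▸ iSup_le fun i =>
      le_iSup (GScheme.TrivializableOpens.toOpens X) ⟨U i, hinv i, hσ i⟩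
  obtain ⟨Z, π, h⟩ := GScheme.TrivializableOpens.exists_isLocallyTrivialPrincipalBundle hX
  exact ⟨Z, π, GScheme.isUniversalCategoricalQuotient_of_isSheafQuotient h.isSheafQuotient, h⟩

theorem mainTheorem8 {S : Scheme.{u}} (G : Over S) [GrpObj G] [IsAffineHom G.hom] [Flat G.hom]
    (X : GScheme G) [IsSeparated X.X.hom] {I : Type*} (U : I → X.X.left.Opens)
    (hcover : (⨆ i, U i) = ⊤) (haff : ∀ i, IsAffineOpen (U i))
    (hinv : ∀ i, X.IsInvariant (U i))
    (hσ : ∀ i, Nonempty (X.restrict (U i) (hinv i) ⟶ GScheme.leftMul G)) :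
    ∃ (Z : Over S) (π : X.X ⟶ Z),
      X.IsUniversalCategoricalQuotient π ∧ X.IsLocallyTrivialPrincipalBundle π :=
  mainTheorem8_general G X U hcover hinv hσ
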